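/- Let $n\ge 1$ and $d\ge 1$ be integers and let $S_n$ be the symmetric group. For $\pi\in S_n$ let $Q_\pi$ be the unitary matrix on $(\mathbb{C}^d)^{\otimes n}$ that acts on the standard basis by $$Q_\pi\,(|i_1\rangle\otimes\cdots\otimes|i_n\rangle)=|i_{\pi^{-1}(1)}\rangle\otimes\cdots\otimes|i_{\pi^{-1}(n)}\rangle ,\qquad i_1,\dots,i_n\in\{1,\dots,d\},$$ and let $L_\pi$ be the matrix of the left regular representation on $\mathbb{C}^{S_n}$, $L_\pi|\sigma\rangle=|\pi\sigma\rangle$. Let $\hat S_n$ be a set consisting of one irreducible unitary matrix representation $\tau:S_n\to \mathrm{U}(d_\tau)$ from each equivalence class of irreducible complex representations of $S_n$. Then the following hold. (i) If $d\ge n$, then there are a (possibly zero-dimensional) unitary representation $\rho$ of $S_n$ and a unitary map $W:(\mathbb{C}^d)^{\otimes n}\to\mathbb{C}^{S_n}\oplus\mathbb{C}^m$, where $m=\dim\rho$, such that $W Q_\pi W^\dagger=L_\pi\oplus\rho(\pi)$ for all $\pi\in S_n$; in particular $Q$ contains the left regular representation as a subrepresentation. (ii) Let $z_\pi\in\mathbb{C}$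 for each $\pi\in S_n$. If $d\ge n$, then $\sum_{\pi\in S_n} z_\pi Q_\pi$ is unitary if and only if $\sum_{\pi\in S_n} z_\pi L_\pi$ is unitary. The implication "if $\sum_\pi z_\pi L_\pi$ is unitary, then $\sum_\pi z_\pi Q_\pi$ is unitary" holds for every $d\ge 1$. (iii) Let $z_\pi\in\mathbb{C}$ for each $\pi\in S_n$. If $d\ge n$, then $\sum_{\pi\in S_n} z_\pi Q_\pi$ is unitary if and only if there are unitary matrices $U_\tau\in \mathrm{U}(d_\tau)$, one for each $\tau\in\hat S_n$, such that $$z_\pi=\sum_{\tau\in\hat S_n}\frac{d_\tau}{n!}\,\mathrm{Tr}\big(\tau(\pi)^\dagger U_\tau\big)\qquad\text{for all }\pi\in S_n .$$ The "if" direction holds for every $d\ge 1$. -/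

import Mathlib

/-! ### Permutation matrices of group actions -/

/-- The permutation matrix of `e`, sending the basis vector `|y⟩` to `|e y⟩`, as a unitary
matrix; multiplicative in `e`. -/
def permUnitary (α : Type*) [Fintype α] [DecidableEq α] :
    Equiv.Perm α →* Matrix.unitaryGroup α ℂ where
  toFun e := ⟨Matrix.of fun x y => if x = e y then 1 else 0, by
    rw [Matrix.mem_unitaryGroup_iff']
    ext x y
    by_cases h : x = y
    · simp [Matrix.mul_apply, Matrix.star_apply, Matrix.one_apply, h]
    · simp [Matrix.mul_apply, Matrix.star_apply, h, Ne.symm h]⟩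
  map_one' := by
    ext x y
    by_cases h : x = y <;> simp [h]
  map_mul' e f := by
    ext x y
    by_cases h : x = e (f y) <;> simp [Matrix.mul_apply, h]

/-- The left regular representation `L` of a finite group: `L g |h⟩ = |g h⟩`. -/
def leftRegularUnitary (G : Type*) [Group G] [Fintype G] [DecidableEq G] :
    G →* Matrix.unitaryGroup G ℂ :=
  (permUnitary G).comp (MulAction.toPermHom G G)

/-- The action of `S_n` on the labels `(i_1, …, i_n)`, with entries in `{1, …, d}`, of the
standard basis of `(ℂ^d)^{⊗n}`: `π` sends `i` to `k ↦ i (π⁻¹ k)`. -/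
def permuteLabels (n d : ℕ) : Equiv.Perm (Fin n) →* Equiv.Perm (Fin n → Fin d) where
  toFun π := Equiv.arrowCongr π (Equiv.refl (Fin d))
  map_one' := rfl
  map_mul' _ _ := rfl

/-- The tensor representation `Q` of `S_n` on `(ℂ^d)^{⊗n}`, in the standard basis
`|i_1⟩ ⊗ ⋯ ⊗ |i_n⟩`, which is indexed by the functions `i : Fin n → Fin d`:
`Q π (|i_1⟩ ⊗ ⋯ ⊗ |i_n⟩) = |i_{π⁻¹(1)}⟩ ⊗ ⋯ ⊗ |i_{π⁻¹(n)}⟩`. -/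
def tensorUnitary (n d : ℕ) :
    Equiv.Perm (Fin n) →* Matrix.unitaryGroup (Fin n → Fin d) ℂ :=
  (permUnitary (Fin n → Fin d)).comp (permuteLabels n d)

theorem leftRegularUnitary_apply {G : Type*} [Group G] [Fintype G] [DecidableEq G] (g x y : G) :
    (leftRegularUnitary G g : Matrix G G ℂ) x y = if x = g * y then 1 else 0 := rfl

theorem tensorUnitary_apply {n d : ℕ} (π : Equiv.Perm (Fin n)) (i j : Fin n → Fin d) :
    (tensorUnitary n d π : Matrix (Fin n → Fin d) (Fin n → Fin d) ℂ) i j =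
      if i = fun k => j (π⁻¹ k) then 1 else 0 := rfl

/-! ### Irreducible unitary representations and the dual of a finite group -/

/-- The linear representation on `ℂ^m` given by a homomorphism into the unitary matrices. -/
def unitaryToRepresentation {G : Type*} [Group G] {m : ℕ}
    (τ : G →* Matrix.unitaryGroup (Fin m) ℂ) : Representation ℂ G (Fin m → ℂ) :=
  (Matrix.toLinAlgEquiv' : Matrix (Fin m) (Fin m) ℂ ≃ₐ[ℂ] _).toAlgHom.toMonoidHom.comp
    ((Matrix.unitaryGroup (Fin m) ℂ).subtype.comp τ)

theorem unitaryToRepresentation_apply {G : Type*} [Group G] {m : ℕ}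
    (τ : G →* Matrix.unitaryGroup (Fin m) ℂ) (g : G) (v : Fin m → ℂ) :
    unitaryToRepresentation τ g v = (τ g : Matrix (Fin m) (Fin m) ℂ).mulVec v := rfl

/-- An irreducible representation of `G` by unitary matrices. -/
structure UnitaryIrrep (G : Type*) [Group G] where
  /-- the dimension -/
  dim : ℕ
  /-- the homomorphism into the unitary matrices -/
  hom : G →* Matrix.unitaryGroup (Fin dim) ℂ
  irreducible : (unitaryToRepresentation hom).IsIrreducible

/-- Equivalence (isomorphism) of irreducible unitary representations. -/
instance UnitaryIrrep.setoid (G : Type*) [Group G] : Setoid (UnitaryIrrep G) where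
  r σ τ := Nonempty ((unitaryToRepresentation σ.hom).Equiv (unitaryToRepresentation τ.hom))
  iseqv :=
    { refl := fun _ => ⟨Representation.Equiv.refl _⟩
      symm := fun ⟨φ⟩ => ⟨φ.symm⟩
      trans := fun ⟨φ⟩ ⟨ψ⟩ => ⟨φ.trans ψ⟩ }

/-- The dual `Ĝ`: equivalence classes of irreducible representations of `G`. -/
def UnitaryDual (G : Type*) [Group G] : Type _ :=
  Quotient (UnitaryIrrep.setoid G)

/-- The equivalence class of an irreducible unitary representation. -/
def UnitaryIrrep.toDual {G : Type*} [Group G] (τ : UnitaryIrrep G) : UnitaryDual G :=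
  Quotient.mk (UnitaryIrrep.setoid G) τ

/-- A finite group has only finitely many irreducible representations up to equivalence,
so that sums over `Ĝ` make sense. -/
instance UnitaryDual.finite (G : Type*) [Group G] [Finite G] : Finite (UnitaryDual G) := by
  classical
  have := Fintype.ofFinite G
  have hG : (Nat.card G : ℂ) ≠ 0 := Nat.cast_ne_zero.mpr Nat.card_pos.ne'
  let _ : Invertible (Nat.card G : ℂ) := invertibleOfNonzero hG
  let ρ : UnitaryDual G → UnitaryIrrep G := Quotient.out
  let χ : UnitaryDual G → G → ℂ := fun c => (unitaryToRepresentation (ρ c).hom).character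
  have key : ∀ c c' : UnitaryDual G,
      (Nat.card G : ℂ)⁻¹ * ∑ g : G, χ c g * χ c' g⁻¹ = if c = c' then 1 else 0 := by
    intro c c'
    have := (ρ c).irreducible
    have := (ρ c').irreducible
    refine (Representation.char_orthonormal (unitaryToRepresentation (ρ c).hom)
      (unitaryToRepresentation (ρ c').hom)).trans ?_
    by_cases h : c = c'
    · subst h
      rw [if_pos ⟨Representation.Equiv.refl _⟩, if_pos rfl]
    · rw [if_neg, if_neg h]
      intro h'
      exact h ((Quotient.out_equiv_out (x := c') (y := c)).mp h').symm
  have hli : LinearIndependent ℂ χ := by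
    rw [linearIndependent_iff']
    intro s a ha c' hc'
    have h1 : ∑ c ∈ s, a c * ((Nat.card G : ℂ)⁻¹ * ∑ g : G, χ c g * χ c' g⁻¹) = 0 := by
      have h2 : ∀ g, ∑ c ∈ s, a c * χ c g = 0 := fun g => by
        simpa using congrFun ha g
      calc _ = (Nat.card G : ℂ)⁻¹ * ∑ g : G, (∑ c ∈ s, a c * χ c g) * χ c' g⁻¹ := by
            simp_rw [Finset.mul_sum, Finset.sum_mul, Finset.mul_sum]
            rw [Finset.sum_comm]
            refine Finset.sum_congr rfl fun g _ => Finset.sum_congr rfl fun c _ => ?_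
            ring
        _ = 0 := by simp [h2]
    simp_rw [key] at h1
    simpa [hc'] using h1
  exact hli.finite

/-- Summation over the dual of a finite group. -/
noncomputable instance UnitaryDual.fintype (G : Type*) [Group G] [Finite G] :
    Fintype (UnitaryDual G) :=
  Fintype.ofFinite _

/-! ### Linear combinations and their parametrization -/

/-- The linear combination `∑ g, z g • ρ g` of the matrices of a unitary representation. -/
def linComb {G α : Type*} [Group G] [Fintype G] [Fintype α] [DecidableEq α]
    (ρ : G →* Matrix.unitaryGroup α ℂ) (z : G → ℂ) : Matrix α α ℂ :=
  ∑ g, z g • (ρ g : Matrix α α ℂ)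

/-- The number `∑_{τ ∈ Ĝ} (d_τ / |G|) Tr (τ(g)† U_τ)`, where `τ c` is a representative of the
class `c ∈ Ĝ`. -/
noncomputable def dualCoeff {G : Type*} [Group G] [Fintype G]
    (τ : UnitaryDual G → UnitaryIrrep G)
    (U : ∀ c : UnitaryDual G, Matrix.unitaryGroup (Fin (τ c).dim) ℂ) (g : G) : ℂ :=
  ∑ c : UnitaryDual G, ((τ c).dim : ℂ) / (Fintype.card G : ℂ) *
    Matrix.trace
      (((τ c).hom g : Matrix (Fin (τ c).dim) (Fin (τ c).dim) ℂ).conjTranspose *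
        (U c : Matrix (Fin (τ c).dim) (Fin (τ c).dim) ℂ))

/-! Unitarity of `∑ g, z g • ρ g` is governed by one convolution identity: the coefficients `k ↦ ∑
h, z (k * h) * star (z h)` are the delta function at `1`. The identity gives unitarity in every
unitary representation. In `L` it is also necessary, since `L` determines coefficients
(`linComb_leftRegularUnitary_injective`). Hence unitarity passes from `L` to `Q` for every `d`.
Conversely, if `d ≥ n`, a basis vector with pairwise distinct labels has a free orbit, which spans a
copy of `L` inside `Q`; a diagonal block of a block diagonal unitary matrix is unitary. The
parametrization is Fourier analysis on a finite group. The decomposition of the regular character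
(`sum_dim_mul_character`) yields both the inversion formula and `∑ d_τ² = |G|`, so the transform is
bijective. It turns the convolution identity into `U_τ U_τ† = 1` for each `τ`. -/

open scoped Matrix

/-! ### Unitarity as a convolution identity -/

section Convolution

variable {G α : Type*} [Group G] [Fintype G] [Fintype α] [DecidableEq α]

theorem linComb_mul_conjTranspose (ρ : G →* Matrix.unitaryGroup α ℂ) (z : G → ℂ) :
    linComb ρ z * (linComb ρ z)ᴴ = linComb ρ fun k => ∑ h, z (k * h) * star (z h) := by
  have hρ : ∀ k h : G, (ρ (k * h) : Matrix α α ℂ) * (ρ h : Matrix α α ℂ)ᴴ = ρ k := fun k h => by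
    rw [map_mul, Submonoid.coe_mul, Matrix.mul_assoc, ← Matrix.star_eq_conjTranspose,
      Matrix.mem_unitaryGroup_iff.mp (ρ h).2, Matrix.mul_one]
  simp only [linComb, Matrix.conjTranspose_sum, Matrix.conjTranspose_smul, Finset.sum_mul_sum,
    Finset.sum_smul]
  rw [Finset.sum_comm]
  conv_rhs => rw [Finset.sum_comm]
  refine Finset.sum_congr rfl fun h _ => ?_
  -- For fixed `h`, substitute `g = k * h`, so that `ρ g * (ρ h)ᴴ` becomes `ρ k`.
  rw [← Equiv.sum_comp (Equiv.mulRight h)]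
  refine Finset.sum_congr rfl fun k _ => ?_
  rw [Equiv.coe_mulRight, smul_mul_smul_comm, hρ]

theorem linComb_single_one [DecidableEq G] (ρ : G →* Matrix.unitaryGroup α ℂ) :
    linComb ρ (Pi.single 1 1) = 1 := by
  simp only [linComb, Pi.single_apply, ite_smul, one_smul, zero_smul, Finset.sum_ite_eq',
    Finset.mem_univ, if_true, map_one, OneMemClass.coe_one]

/-- Unitarity of a linear combination follows from the unitarity of the coefficients with respect
to convolution. -/
theorem linComb_mem_unitaryGroup_of_convolution [DecidableEq G]
    (ρ : G →* Matrix.unitaryGroup α ℂ) {z : G → ℂ}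
    (hz : (fun k => ∑ h, z (k * h) * star (z h)) = Pi.single 1 1) :
    linComb ρ z ∈ Matrix.unitaryGroup α ℂ := by
  rw [Matrix.mem_unitaryGroup_iff, Matrix.star_eq_conjTranspose, linComb_mul_conjTranspose, hz,
    linComb_single_one]

/-- The column of the matrix at `1` is `z` itself. -/
theorem linComb_leftRegularUnitary_injective [DecidableEq G] :
    Function.Injective (linComb (leftRegularUnitary G)) := by
  have h : ∀ (z : G → ℂ) (x : G), linComb (leftRegularUnitary G) z x 1 = z x := fun z x => by
    simp [linComb, Matrix.sum_apply, leftRegularUnitary_apply]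
  intro z w hzw
  ext x
  rw [← h z, hzw, h]

/-- A linear combination that is unitary in the left regular representation is unitary in every
unitary representation. -/
theorem linComb_mem_unitaryGroup_of_leftRegularUnitary [DecidableEq G]
    (ρ : G →* Matrix.unitaryGroup α ℂ) {z : G → ℂ}
    (hz : linComb (leftRegularUnitary G) z ∈ Matrix.unitaryGroup G ℂ) :
    linComb ρ z ∈ Matrix.unitaryGroup α ℂ := by
  apply linComb_mem_unitaryGroup_of_convolution
  apply linComb_leftRegularUnitary_injective
  rw [← linComb_mul_conjTranspose, linComb_single_one]
  exact Matrix.mem_unitaryGroup_iff.mp hz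

end Convolution

/-! ### The regular representation inside the tensor representation -/

section Contains

/-- If a permutation action of `G` has a free orbit, then its permutation representation is the
direct sum of the left regular representation and a unitary representation. -/
theorem permUnitary_comp_eq_leftRegularUnitary_sum {G X : Type*} [Group G] [Fintype G]
    [DecidableEq G] [Fintype X] [DecidableEq X] (P : G →* Equiv.Perm X) (j : G → X)
    (hj : Function.Injective j) (hP : ∀ g h, P g (j h) = j (g * h)) :
    ∃ (m : ℕ) (σ : G →* Matrix.unitaryGroup (Fin m) ℂ) (W : Matrix (G ⊕ Fin m) X ℂ),
      W * Wᴴ = 1 ∧ Wᴴ * W = 1 ∧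
      ∀ g, W * (permUnitary X (P g) : Matrix X X ℂ) * Wᴴ =
        Matrix.fromBlocks (leftRegularUnitary G g : Matrix G G ℂ) 0 0
          (σ g : Matrix (Fin m) (Fin m) ℂ) := by
  classical
  have hmem : ∀ g x, P g x ∈ Set.range j ↔ x ∈ Set.range j := fun g x => by
    constructor
    · rintro ⟨h, hh⟩
      refine ⟨g⁻¹ * h, ?_⟩
      rw [← hP, hh, ← Equiv.Perm.mul_apply, ← map_mul, inv_mul_cancel,
        map_one, Equiv.Perm.one_apply]
    · rintro ⟨h, rfl⟩
      exact ⟨g * h, (hP g h).symm⟩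
  let R : G →* Equiv.Perm ((Set.range j)ᶜ : Set X) :=
    { toFun := fun g => (P g).subtypePerm fun x => not_congr (hmem g x)
      map_one' := by ext x; simp
      map_mul' := fun g h => by
        ext x
        exact Equiv.congr_fun (map_mul P g h) x }
  let s := Fintype.equivFin ((Set.range j)ᶜ : Set X)
  let σ : G →* Equiv.Perm (Fin _) := s.permCongrHom.toMonoidHom.comp R
  let e : G ⊕ Fin _ ≃ X :=
    ((Equiv.ofInjective j hj).sumCongr s.symm).trans (Equiv.Set.sumCompl (Set.range j))
  have hel : ∀ g, e (Sum.inl g) = j g := fun g => rfl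
  have her : ∀ i, e (Sum.inr i) = (s.symm i : X) := fun i => rfl
  have hPr : ∀ g i, P g (e (Sum.inr i)) = e (Sum.inr (σ g i)) := fun g i => by
    simp [her, σ, R]
  have hPl : ∀ g h, P g (e (Sum.inl h)) = e (Sum.inl (g * h)) := fun g h => by
    rw [hel, hel, hP]
  -- `W` is the permutation matrix that lists the free orbit first and its complement second, so
  -- conjugation by it only reindexes by `e`.
  refine ⟨_, (permUnitary _).comp σ, (1 : Matrix X X ℂ).submatrix e id, ?_, ?_, fun g => ?_⟩
  · ext a b
    simp [Matrix.mul_apply, Matrix.one_apply]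
  · ext a b
    refine (e.sum_comp fun x => star ((1 : Matrix X X ℂ) x a) * (1 : Matrix X X ℂ) x b).trans ?_
    simp [Matrix.one_apply, eq_comm]
  · have hW : (1 : Matrix X X ℂ).submatrix e id * (permUnitary X (P g) : Matrix X X ℂ) *
        ((1 : Matrix X X ℂ).submatrix e id)ᴴ =
          (permUnitary X (P g) : Matrix X X ℂ).submatrix e e := by
      ext a b
      simp [Matrix.mul_apply, Matrix.one_apply]
    rw [hW]
    have hperm : ∀ x y : X, (permUnitary X (P g) : Matrix X X ℂ) x y =
      if x = P g y then 1 else 0 := fun _ _ => rfl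
    ext (a | a) (b | b)
    · simp [hperm, hPl, leftRegularUnitary_apply]
    · simp [hperm, hPr]
    · simp [hperm, hPl]
    · simp only [Matrix.submatrix_apply, hperm, hPr, Matrix.fromBlocks_apply₂₂, e.injective.eq_iff,
        Sum.inr.injEq]
      rfl

theorem linComb_conj_fromBlocks {G α β γ : Type*} [Group G] [Fintype G] [Fintype α]
    [DecidableEq α] [Fintype β] [DecidableEq β] [Fintype γ] [DecidableEq γ]
    {ρ : G →* Matrix.unitaryGroup α ℂ} {L : G →* Matrix.unitaryGroup β ℂ}
    {σ : G →* Matrix.unitaryGroup γ ℂ} {W : Matrix (β ⊕ γ) α ℂ}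
    (h : ∀ g, W * (ρ g : Matrix α α ℂ) * Wᴴ =
      Matrix.fromBlocks (L g : Matrix β β ℂ) 0 0 (σ g : Matrix γ γ ℂ)) (z : G → ℂ) :
    W * linComb ρ z * Wᴴ = Matrix.fromBlocks (linComb L z) 0 0 (linComb σ z) := by
  simp only [linComb, Matrix.mul_sum, Matrix.sum_mul, Matrix.mul_smul, Matrix.smul_mul, h]
  ext (a | a) (b | b) <;> simp [Matrix.sum_apply]

/-- A summand of a unitary representation takes a unitary linear combination to a unitary
matrix. -/
theorem linComb_mem_unitaryGroup_of_conj_fromBlocks {G α β γ : Type*} [Group G] [Fintype G]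
    [Fintype α] [DecidableEq α] [Fintype β] [DecidableEq β] [Fintype γ] [DecidableEq γ]
    {ρ : G →* Matrix.unitaryGroup α ℂ} {L : G →* Matrix.unitaryGroup β ℂ}
    {σ : G →* Matrix.unitaryGroup γ ℂ} {W : Matrix (β ⊕ γ) α ℂ} (hW : W * Wᴴ = 1)
    (hW' : Wᴴ * W = 1)
    (h : ∀ g, W * (ρ g : Matrix α α ℂ) * Wᴴ =
      Matrix.fromBlocks (L g : Matrix β β ℂ) 0 0 (σ g : Matrix γ γ ℂ)) {z : G → ℂ}
    (hz : linComb ρ z ∈ Matrix.unitaryGroup α ℂ) :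
    linComb L z ∈ Matrix.unitaryGroup β ℂ := by
  have h1 : (W * linComb ρ z * Wᴴ) * (W * linComb ρ z * Wᴴ)ᴴ = 1 := by
    calc _ = W * (linComb ρ z * (Wᴴ * W) * (linComb ρ z)ᴴ) * Wᴴ := by
          simp only [Matrix.conjTranspose_mul, Matrix.conjTranspose_conjTranspose, Matrix.mul_assoc]
      _ = 1 := by
          rw [hW', Matrix.mul_one, ← Matrix.star_eq_conjTranspose (linComb ρ z),
            Matrix.mem_unitaryGroup_iff.mp hz, Matrix.mul_one, hW]
  rw [linComb_conj_fromBlocks h, Matrix.fromBlocks_conjTranspose, Matrix.fromBlocks_multiply,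
    ← Matrix.fromBlocks_one] at h1
  have h2 := (Matrix.fromBlocks_inj.mp h1).1
  rw [Matrix.mem_unitaryGroup_iff, Matrix.star_eq_conjTranspose]
  simpa using h2

/-- For `d ≥ n` the tensor representation contains the left regular representation. -/
theorem tensorUnitary_eq_leftRegularUnitary_sum {n d : ℕ} (hnd : n ≤ d) :
    ∃ (m : ℕ) (σ : Equiv.Perm (Fin n) →* Matrix.unitaryGroup (Fin m) ℂ)
      (W : Matrix (Equiv.Perm (Fin n) ⊕ Fin m) (Fin n → Fin d) ℂ),
      W * Wᴴ = 1 ∧ Wᴴ * W = 1 ∧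
      ∀ π : Equiv.Perm (Fin n),
        W * (tensorUnitary n d π : Matrix (Fin n → Fin d) (Fin n → Fin d) ℂ) * Wᴴ =
          Matrix.fromBlocks
            (leftRegularUnitary (Equiv.Perm (Fin n)) π :
              Matrix (Equiv.Perm (Fin n)) (Equiv.Perm (Fin n)) ℂ)
            0 0 (σ π : Matrix (Fin m) (Fin m) ℂ) := by
  refine permUnitary_comp_eq_leftRegularUnitary_sum (permuteLabels n d)
    -- The orbit of the tuple of labels `(1, …, n)`, available because `n ≤ d`; its entries are
    -- distinct, so the orbit is free.
    (fun g k => Fin.castLE hnd (g⁻¹ k)) (fun g h hgh => ?_) fun g h => ?_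
  · apply inv_injective
    ext1 k
    exact Fin.castLE_injective hnd (congrFun hgh k)
  · rw [mul_inv_rev]
    rfl

end Contains

/-! ### Complete reducibility, at the level of characters -/

section UnitaryReps

variable {G : Type*} [Group G]

/-- An equivalence matches invariant subspaces, so the two lattices of subrepresentations are
isomorphic. -/
theorem Representation.IsIrreducible.of_equiv {k V W : Type*} [Field k] [AddCommGroup V]
    [Module k V] [AddCommGroup W] [Module k W] {ρ : Representation k G V}
    {σ : Representation k G W} (φ : ρ.Equiv σ) (hρ : ρ.IsIrreducible) : σ.IsIrreducible := by
  let f : V ≃ₗ[k] W := φ.toLinearEquiv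
  have hf : ∀ g x, f (ρ g x) = σ g (f x) := fun g x => φ.toIntertwiningMap.isIntertwining _ _ g x
  let e : Subrepresentation σ ≃o Subrepresentation ρ :=
    { toFun := fun p => ⟨p.toSubmodule.comap f.toLinearMap, fun g v hv => by
        rw [Submodule.mem_comap, LinearEquiv.coe_coe, hf]
        exact p.apply_mem_toSubmodule g hv⟩
      invFun := fun p => ⟨p.toSubmodule.map f.toLinearMap, by
        rintro g _ ⟨v, hv, rfl⟩
        exact ⟨ρ g v, p.apply_mem_toSubmodule g hv, hf g v⟩⟩
      left_inv := fun p => Subrepresentation.toSubmodule_injective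
        (Submodule.map_comap_eq_of_surjective f.surjective _)
      right_inv := fun p => Subrepresentation.toSubmodule_injective
        (Submodule.comap_map_eq_of_injective f.injective _)
      map_rel_iff' := Submodule.comap_le_comap_iff_of_surjective f.surjective }
  exact e.isSimpleOrder

variable {E : Type*} [NormedAddCommGroup E] [InnerProductSpace ℂ E] [FiniteDimensional ℂ E]

/-- An irreducible isometric representation is equivalent to one by unitary matrices. -/
theorem Representation.IsIrreducible.exists_unitaryIrrep {ρ : Representation ℂ G E}
    (hρ : ∀ g x y, inner ℂ (ρ g x) (ρ g y) = inner ℂ x y) (hirr : ρ.IsIrreducible) :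
    ∃ τ : UnitaryIrrep G, Nonempty (ρ.Equiv (unitaryToRepresentation τ.hom)) := by
  let b := stdOrthonormalBasis ℂ E
  have hmem : ∀ g, LinearMap.toMatrixOrthonormal b (ρ g) ∈
      Matrix.unitaryGroup (Fin (Module.finrank ℂ E)) ℂ := fun g => by
    rw [Matrix.mem_unitaryGroup_iff', ← map_star, ← map_mul,
      ← map_one (LinearMap.toMatrixOrthonormal b)]
    congr 1
    ext x
    refine ext_inner_left ℂ fun y => ?_
    rw [Module.End.mul_apply, LinearMap.star_eq_adjoint, LinearMap.adjoint_inner_right, hρ,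
      Module.End.one_apply]
  let M : G →* Matrix.unitaryGroup (Fin (Module.finrank ℂ E)) ℂ :=
    { toFun := fun g => ⟨_, hmem g⟩
      map_one' := by
        apply Subtype.ext
        simp only [map_one]
        rfl
      map_mul' := fun g h => by
        apply Subtype.ext
        simp only [map_mul]
        rfl }
  let φ : ρ.Equiv (unitaryToRepresentation M) :=
    Representation.Equiv.mk b.toBasis.equivFun fun g => LinearMap.ext fun x =>
      (LinearMap.toMatrix_mulVec_repr b.toBasis b.toBasis (ρ g) x).symm
  exact ⟨⟨_, M, hirr.of_equiv φ⟩, ⟨φ⟩⟩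

/-- The character of an isometric representation is a combination of irreducible characters. -/
theorem exists_character_eq_sum_irreducible [Finite G] {τ : UnitaryDual G → UnitaryIrrep G}
    (hτ : ∀ c, (τ c).toDual = c) {ρ : Representation ℂ G E}
    (hρ : ∀ g x y, inner ℂ (ρ g x) (ρ g y) = inner ℂ x y) :
    ∃ m : UnitaryDual G → ℂ, ∀ g,
      ρ.character g = ∑ c, m c * (unitaryToRepresentation (τ c).hom).character g := by
  classical
  -- Induction on the dimension: a nonzero reducible space splits into an invariant subspace and its
  -- orthogonal complement.
  induction hN : Module.finrank ℂ E using Nat.strong_induction_on generalizing E with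
  | _ N ih =>
  by_cases hirr : ρ.IsIrreducible
  · obtain ⟨σ, ⟨φ⟩⟩ := hirr.exists_unitaryIrrep hρ
    obtain ⟨ψ⟩ : σ ≈ τ σ.toDual := Quotient.exact (hτ σ.toDual).symm
    refine ⟨Pi.single σ.toDual 1, fun g => ?_⟩
    rw [Representation.char_iso (φ.trans ψ)]
    simp [Pi.single_apply]
  · rcases subsingleton_or_nontrivial E with hE | hE
    · refine ⟨0, fun g => ?_⟩
      simp [Representation.character, Subsingleton.elim (ρ g) 0]
    · obtain ⟨p, hp, hp'⟩ : ∃ p : Subrepresentation ρ, p.toSubmodule ≠ ⊥ ∧ p.toSubmodule ≠ ⊤ := by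
        by_contra! h
        exact hirr
          { exists_pair_ne := ⟨⊥, ⊤, fun hbt => bot_ne_top (α := Submodule ℂ E)
              (congrArg Subrepresentation.toSubmodule hbt)⟩
            eq_bot_or_eq_top := fun p => (eq_or_ne p.toSubmodule ⊥).imp
              (fun hp => Subrepresentation.toSubmodule_injective hp)
              fun hp => Subrepresentation.toSubmodule_injective (h p hp) }
      -- The adjoint of `ρ g` is `ρ g⁻¹`, which makes the orthogonal complement of `p` invariant.
      have hinv : ∀ g x y, inner ℂ x (ρ g y) = inner ℂ (ρ g⁻¹ x) y := fun g x y => by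
        rw [← hρ g (ρ g⁻¹ x) y, Representation.self_inv_apply]
      let q : Subrepresentation ρ := ⟨p.toSubmoduleᗮ, fun g v hv w hw => by
        rw [hinv]
        exact hv _ (p.apply_mem_toSubmodule _ hw)⟩
      obtain ⟨m₁, h₁⟩ := ih _ (hN ▸ Submodule.finrank_lt hp') (ρ := p.toRepresentation)
        (fun g x y => hρ g x y) rfl
      obtain ⟨m₂, h₂⟩ := ih (Module.finrank ℂ q.toSubmodule) (hN ▸ Submodule.finrank_lt (by
        rwa [Ne, Submodule.orthogonal_eq_top_iff])) (ρ := q.toRepresentation)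
        (fun g x y => hρ g x y) rfl
      refine ⟨m₁ + m₂, fun g => ?_⟩
      simp only [Pi.add_apply, add_mul, Finset.sum_add_distrib, ← h₁, ← h₂]
      let A : Bool → Submodule ℂ E := fun i => cond i p.toSubmodule q.toSubmodule
      have hA : DirectSum.IsInternal A :=
        (DirectSum.isInternal_submodule_iff_isCompl A (i := true) (j := false) (by decide)
          (by ext i; cases i <;> simp)).mpr p.toSubmodule.isCompl_orthogonal
      have hf : ∀ i, Set.MapsTo (ρ g) (A i) (A i) := by
        rintro (_ | _)
        · exact q.apply_mem_toSubmodule g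
        · exact p.apply_mem_toSubmodule g
      rw [Representation.character, LinearMap.trace_eq_sum_trace_restrict hA hf, Fintype.sum_bool]
      rfl

end UnitaryReps

theorem character_unitaryToRepresentation {G : Type*} [Group G] {m : ℕ}
    (τ : G →* Matrix.unitaryGroup (Fin m) ℂ) (g : G) :
    (unitaryToRepresentation τ).character g = (τ g : Matrix (Fin m) (Fin m) ℂ).trace :=
  Matrix.trace_toLin'_eq _

/-! ### Fourier transform on a finite group -/

section Fourier

variable {G : Type*} [Group G] [Fintype G]

/-- The left regular representation on the Hilbert space of functions on `G`. -/
noncomputable def euclideanRegular (G : Type*) [Group G] [Fintype G] :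
    Representation ℂ G (EuclideanSpace ℂ G) where
  toFun g := (LinearIsometryEquiv.piLpCongrLeft 2 ℂ ℂ (Equiv.mulLeft g)).toLinearEquiv.toLinearMap
  map_one' := by
    ext
    simp
    rfl
  map_mul' g h := by
    ext
    simp
    rfl

theorem euclideanRegular_inner (g : G) (x y : EuclideanSpace ℂ G) :
    inner ℂ (euclideanRegular G g x) (euclideanRegular G g y) = inner ℂ x y :=
  (LinearIsometryEquiv.piLpCongrLeft 2 ℂ ℂ (Equiv.mulLeft g)).inner_map_map x y

/-- Left multiplication by `g ≠ 1` has no fixed points. -/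
theorem euclideanRegular_character [DecidableEq G] (g : G) :
    (euclideanRegular G).character g = if g = 1 then (Fintype.card G : ℂ) else 0 := by
  rw [Representation.character, LinearMap.trace_eq_matrix_trace ℂ (PiLp.basisFun 2 ℂ G),
    Matrix.trace]
  have h : ∀ x : G, (LinearMap.toMatrix (PiLp.basisFun 2 ℂ G) (PiLp.basisFun 2 ℂ G)
      (euclideanRegular G g)).diag x = if g = 1 then 1 else 0 := fun x => by
    simp [LinearMap.toMatrix_apply, euclideanRegular]
  simp only [h]
  split_ifs <;> simp

variable {τ : UnitaryDual G → UnitaryIrrep G}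

theorem char_orthonormal_unitaryDual (hτ : ∀ c, (τ c).toDual = c) [DecidableEq (UnitaryDual G)]
    (c c' : UnitaryDual G) :
    (Nat.card G : ℂ)⁻¹ * ∑ g : G, (unitaryToRepresentation (τ c).hom).character g *
      (unitaryToRepresentation (τ c').hom).character g⁻¹ = if c = c' then 1 else 0 := by
  have hG : (Nat.card G : ℂ) ≠ 0 := Nat.cast_ne_zero.mpr Nat.card_pos.ne'
  let _ : Invertible (Nat.card G : ℂ) := invertibleOfNonzero hG
  have := (τ c).irreducible
  have := (τ c').irreducible
  refine (Representation.char_orthonormal (unitaryToRepresentation (τ c).hom)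
    (unitaryToRepresentation (τ c').hom)).trans ?_
  by_cases h : c = c'
  · subst h
    rw [if_pos ⟨Representation.Equiv.refl _⟩, if_pos rfl]
  · rw [if_neg, if_neg h]
    intro h'
    have : (τ c').toDual = (τ c).toDual := Quotient.sound h'
    rw [hτ, hτ] at this
    exact h this.symm

/-- The decomposition of the regular character. -/
theorem sum_dim_mul_character (hτ : ∀ c, (τ c).toDual = c) [DecidableEq G] (g : G) :
    ∑ c, ((τ c).dim : ℂ) * ((τ c).hom g : Matrix (Fin (τ c).dim) (Fin (τ c).dim) ℂ).trace =
      if g = 1 then (Fintype.card G : ℂ) else 0 := by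
  classical
  obtain ⟨m, hm⟩ := exists_character_eq_sum_irreducible hτ (euclideanRegular_inner (G := G))
  -- By orthonormality, `m c` is the inner product of the regular character with the character of `τ
  -- c`; only `g = 1` contributes.
  have hdim : ∀ c, m c = (τ c).dim := fun c => by
    have h1 : (Nat.card G : ℂ)⁻¹ * ∑ g : G, (euclideanRegular G).character g *
        (unitaryToRepresentation (τ c).hom).character g⁻¹ = (τ c).dim := by
      simp [euclideanRegular_character]
    rw [← h1]
    simp_rw [hm, Finset.sum_mul, mul_assoc]
    rw [Finset.sum_comm]
    simp_rw [← Finset.mul_sum]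
    rw [Finset.mul_sum]
    simp_rw [mul_left_comm _ (m _), char_orthonormal_unitaryDual hτ]
    simp
  rw [← euclideanRegular_character, hm]
  simp_rw [hdim, character_unitaryToRepresentation]

/-- Fourier inversion. -/
theorem sum_trace_mul_linComb (hτ : ∀ c, (τ c).toDual = c) (z : G → ℂ) (g : G) :
    ∑ c : UnitaryDual G, ((τ c).dim : ℂ) / (Fintype.card G : ℂ) *
      Matrix.trace (((τ c).hom g : Matrix (Fin (τ c).dim) (Fin (τ c).dim) ℂ)ᴴ *
        linComb (τ c).hom z) = z g := by
  classical
  have hG : (Fintype.card G : ℂ) ≠ 0 := Nat.cast_ne_zero.mpr Fintype.card_ne_zero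
  have h : ∀ c h, ((τ c).hom g : Matrix (Fin (τ c).dim) (Fin (τ c).dim) ℂ)ᴴ * (τ c).hom h =
      ((τ c).hom (g⁻¹ * h) : Matrix (Fin (τ c).dim) (Fin (τ c).dim) ℂ) := fun c h => by
    rw [map_mul, map_inv]
    rfl
  simp only [linComb, Matrix.mul_smul, Matrix.trace_sum, Matrix.trace_smul,
    Finset.mul_sum]
  simp_rw [h]
  rw [Finset.sum_comm]
  have h' : ∀ x, ∑ c, ((τ c).dim : ℂ) / (Fintype.card G : ℂ) *
      z x • ((τ c).hom (g⁻¹ * x) : Matrix (Fin (τ c).dim) (Fin (τ c).dim) ℂ).trace =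
        if x = g then z x else 0 := fun x => by
    calc _ = z x / (Fintype.card G : ℂ) * ∑ c, ((τ c).dim : ℂ) *
          ((τ c).hom (g⁻¹ * x) : Matrix (Fin (τ c).dim) (Fin (τ c).dim) ℂ).trace := by
          rw [Finset.mul_sum]
          refine Finset.sum_congr rfl fun c _ => ?_
          rw [smul_eq_mul]
          ring
      _ = _ := by
          rw [sum_dim_mul_character hτ]
          by_cases hx : x = g
          · simp [hx, hG]
          · rw [if_neg hx, if_neg, mul_zero]
            rwa [inv_mul_eq_one, eq_comm]
  simp_rw [h']
  simp

/-- The Fourier transform on `G`, with values in the matrix algebras of the irreducible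
representations. -/
def unitaryDualTransform (τ : UnitaryDual G → UnitaryIrrep G) :
    (G → ℂ) →ₗ[ℂ] ∀ c, Matrix (Fin (τ c).dim) (Fin (τ c).dim) ℂ where
  toFun z c := linComb (τ c).hom z
  map_add' z w := by
    ext1 c
    simp [linComb, add_smul, Finset.sum_add_distrib]
  map_smul' a z := by
    ext1 c
    simp [linComb, mul_smul, Finset.smul_sum]

theorem unitaryDualTransform_injective (hτ : ∀ c, (τ c).toDual = c) :
    Function.Injective (unitaryDualTransform τ) := by
  intro z w hzw
  ext g
  have h : ∀ c, linComb (τ c).hom z = linComb (τ c).hom w := fun c => congrFun hzw c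
  rw [← sum_trace_mul_linComb hτ z g, ← sum_trace_mul_linComb hτ w g]
  simp_rw [h]

/-- An injective linear map between spaces of equal dimension is surjective; the regular character
at `1` gives `∑ d_τ² = |G|`. -/
theorem unitaryDualTransform_surjective (hτ : ∀ c, (τ c).toDual = c) :
    Function.Surjective (unitaryDualTransform τ) := by
  classical
  refine (LinearMap.injective_iff_surjective_of_finrank_eq_finrank ?_).mp
    (unitaryDualTransform_injective hτ)
  have h := sum_dim_mul_character hτ 1
  simp only [map_one, OneMemClass.coe_one, Matrix.trace_one, Fintype.card_fin, if_true] at h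
  rw [Module.finrank_fintype_fun_eq_card, Module.finrank_pi_fintype]
  simp only [Module.finrank_matrix, Module.finrank_self, Fintype.card_fin, mul_one]
  exact_mod_cast h.symm

/-- The parametrization of the unitary elements of the group algebra. -/
theorem linComb_leftRegularUnitary_mem_unitaryGroup_iff [DecidableEq G]
    (hτ : ∀ c, (τ c).toDual = c) (z : G → ℂ) :
    linComb (leftRegularUnitary G) z ∈ Matrix.unitaryGroup G ℂ ↔
      ∃ U : ∀ c, Matrix.unitaryGroup (Fin (τ c).dim) ℂ, ∀ g, z g = dualCoeff τ U g := by
  constructor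
  · intro hz
    exact ⟨fun c => ⟨_, linComb_mem_unitaryGroup_of_leftRegularUnitary (τ c).hom hz⟩,
      fun g => (sum_trace_mul_linComb hτ z g).symm⟩
  · rintro ⟨U, hU⟩
    obtain ⟨w, hw⟩ := unitaryDualTransform_surjective hτ fun c => (U c : Matrix _ _ ℂ)
    have hw' : ∀ c, linComb (τ c).hom w = U c := fun c => congrFun hw c
    obtain rfl : z = w := by
      ext g
      rw [hU, ← sum_trace_mul_linComb hτ w g]
      simp_rw [hw']
      rfl
    apply linComb_mem_unitaryGroup_of_convolution
    -- The convolution identity may be checked after the transform, where it reads `U c * (U c)ᴴ =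
    -- 1`.
    apply unitaryDualTransform_injective hτ
    ext1 c
    change linComb (τ c).hom _ = linComb (τ c).hom _
    rw [← linComb_mul_conjTranspose, linComb_single_one, hw', ← Matrix.star_eq_conjTranspose]
    exact Matrix.mem_unitaryGroup_iff.mp (U c).2

end Fourier

theorem mainTheorem3 (n d : ℕ) (hd : 1 ≤ d) :
    -- for `d ≥ n`, `Q ≅ L ⊕ σ` (unitary equivalence) for some unitary representation `σ`
    (n ≤ d →
      ∃ (m : ℕ) (σ : Equiv.Perm (Fin n) →* Matrix.unitaryGroup (Fin m) ℂ)
        (W : Matrix (Equiv.Perm (Fin n) ⊕ Fin m) (Fin n → Fin d) ℂ),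
        W * W.conjTranspose = 1 ∧ W.conjTranspose * W = 1 ∧
        ∀ π : Equiv.Perm (Fin n),
          W * (tensorUnitary n d π : Matrix (Fin n → Fin d) (Fin n → Fin d) ℂ) *
              W.conjTranspose =
            Matrix.fromBlocks
              (leftRegularUnitary (Equiv.Perm (Fin n)) π :
                Matrix (Equiv.Perm (Fin n)) (Equiv.Perm (Fin n)) ℂ)
              0 0 (σ π : Matrix (Fin m) (Fin m) ℂ)) ∧
    -- the reduction from `Q` to `L`
    (∀ z : Equiv.Perm (Fin n) → ℂ,
      (n ≤ d →
        (linComb (tensorUnitary n d) z ∈ Matrix.unitaryGroup (Fin n → Fin d) ℂ ↔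
          linComb (leftRegularUnitary (Equiv.Perm (Fin n))) z ∈
            Matrix.unitaryGroup (Equiv.Perm (Fin n)) ℂ)) ∧
      (linComb (leftRegularUnitary (Equiv.Perm (Fin n))) z ∈
          Matrix.unitaryGroup (Equiv.Perm (Fin n)) ℂ →
        linComb (tensorUnitary n d) z ∈ Matrix.unitaryGroup (Fin n → Fin d) ℂ)) ∧
    -- the parametrization, for any choice `τ` of one representative in each class of irreps
    (∀ τ : UnitaryDual (Equiv.Perm (Fin n)) → UnitaryIrrep (Equiv.Perm (Fin n)),
      (∀ c, (τ c).toDual = c) →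
      ∀ z : Equiv.Perm (Fin n) → ℂ,
        (n ≤ d →
          (linComb (tensorUnitary n d) z ∈ Matrix.unitaryGroup (Fin n → Fin d) ℂ ↔
            ∃ U : ∀ c, Matrix.unitaryGroup (Fin (τ c).dim) ℂ, ∀ π, z π = dualCoeff τ U π)) ∧
        ((∃ U : ∀ c, Matrix.unitaryGroup (Fin (τ c).dim) ℂ, ∀ π, z π = dualCoeff τ U π) →
          linComb (tensorUnitary n d) z ∈ Matrix.unitaryGroup (Fin n → Fin d) ℂ)) := by
  refine ⟨tensorUnitary_eq_leftRegularUnitary_sum, ?_, ?_⟩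
  · refine fun z => ⟨fun hnd => ⟨fun hz => ?_, ?_⟩, ?_⟩
    · obtain ⟨m, σ, W, hW, hW', h⟩ := tensorUnitary_eq_leftRegularUnitary_sum hnd
      exact linComb_mem_unitaryGroup_of_conj_fromBlocks hW hW' h hz
    all_goals exact linComb_mem_unitaryGroup_of_leftRegularUnitary _
  · intro τ hτ z
    -- The parametrization is replaced by unitarity in `L`, which leaves the previous comparison of
    -- `Q` with `L`.
    simp only [← linComb_leftRegularUnitary_mem_unitaryGroup_iff hτ]
    refine ⟨fun hnd => ⟨fun hz => ?_, ?_⟩, ?_⟩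
    · obtain ⟨m, σ, W, hW, hW', h⟩ := tensorUnitary_eq_leftRegularUnitary_sum hnd
      exact linComb_mem_unitaryGroup_of_conj_fromBlocks hW hW' h hz
    all_goals exact linComb_mem_unitaryGroup_of_leftRegularUnitary _
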